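/- Let $K$ be a compact connected Lie group, realized as a compact subgroup of $GL(m,\mathbb{C})$. Let $i\colon K\to G=K_{\mathbb{C}}$ be its analytic complexification: $G$ is a complex Lie group, $i$ is a Lie group homomorphism, and every Lie group homomorphism $\varphi\colon K\to H$ into a complex Lie group $H$ is $\Phi\circ i$ for a unique complex analytic homomorphism $\Phi\colon G\to H$. Let $j\colon G\to GL(m,\mathbb{C})$ be the complex analytic homomorphism that extends the inclusion of $K$, and let $\mathbb{C}[G]$ be the algebra of algebraic functions on $G$, i.e. of all polynomials in the matrix entries of $j(g)$ and $\det(j(g))^{-1}$. Let $G$ act on $\mathbb{C}[G]$ by left translations, $(g\cdot f)(x)=f(g^{-1}x)$, or by right translations, $(g\cdot f)(x)=f(xg)$; the assertion holds for either choice. For a finite-dimensional irreducible representation $\pi$ of $G$ let $\mathbb{C}[G]_\pi$ be the $\pi$-isotypical component, i.e. the sum of all subrepresentations of $\mathbb{C}[G]$ equivalent to $\pi$, and let $(f)_\pi$ be the projection of $f\in\mathbb{C}[G]$ onto $\mathbb{C}[G]_\pi$ along the sum of the finite-dimensional irreducible subrepresentations not equivalent to $\pi$. Let $\mathrm{triv}$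 be the trivial representation on $\mathbb{C}$. A finite-type function on $K$ is a finite linear combination of matrix coefficients $k\mapsto\langle\sigma(k)v,u\rangle$ of finite-dimensional continuous representations $\sigma$ of $K$ on complex Hilbert spaces. Assume the Mathieu Conjecture for $K$: if $\varphi$ and $h$ are finite-type functions on $K$ and $\int_K\varphi(k)^n\,dk=0$ for all integers $n\ge 1$, where $dk$ is the normalized Haar measure, then $\int_K\varphi(k)^n h(k)\,dk=0$ for all sufficiently large $n$. Let $f\in\mathbb{C}[G]$ satisfy $(f^n)_{\mathrm{triv}}=0$ for all integers $n\ge 1$, and let $(\pi,V_\pi)$ be a finite-dimensional irreducible (continuous) representation of $G$. Then $\mathbb{C}[G]$ is the direct sum of $\mathbb{C}[G]_\pi$ and the sum of the finite-dimensional irreducible subrepresentations not equivalent to $\pi$ (so that $(\cdot)_\pi$ is well defined), and there is an $N$, which may depend on $f$ and $\pi$, such that $(f^n)_\pi=0$ for all $n\ge N$. -/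

import Mathlib

open scoped Manifold ContDiff

noncomputable section

/-! ### Finite-type functions and the Mathieu Conjecture for a compact group -/

/-- `f` is a matrix coefficient `k ↦ ⟨π(k) v, u⟩` of a finite-dimensional (continuous) representation
`π` of `K` on a nonzero complex Hilbert space. Mathlib's `inner ℂ u w` is conjugate-linear in `u`. -/
def IsMatrixCoefficient (K : Type) [Group K] [TopologicalSpace K] (f : K → ℂ) : Prop :=
  ∃ (V : Type) (_ : NormedAddCommGroup V) (_ : InnerProductSpace ℂ V)
    (_ : FiniteDimensional ℂ V) (_ : Nontrivial V) (π : Representation ℂ K V),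
    Continuous (fun p : K × V => π p.1 p.2) ∧
      ∃ u v : V, f = fun k => inner ℂ u (π k v)

/-- A finite-type function is a finite linear combination of matrix coefficients. -/
def IsFiniteType (K : Type) [Group K] [TopologicalSpace K] (f : K → ℂ) : Prop :=
  f ∈ Submodule.span ℂ {m : K → ℂ | IsMatrixCoefficient K m}

/-- The Haar measure of total mass one on a compact group (with its Borel σ-algebra). -/
def normalizedHaar (K : Type) [Group K] [TopologicalSpace K] [IsTopologicalGroup K]
    [CompactSpace K] : @MeasureTheory.Measure K (borel K) :=
  letI : MeasurableSpace K := borel K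
  haveI : BorelSpace K := ⟨rfl⟩
  MeasureTheory.Measure.haarMeasure (⊤ : TopologicalSpace.PositiveCompacts K)

/-- The assertion of the Mathieu Conjecture for the (compact connected Lie) group `K`. -/
def MathieuConjecture (K : Type) [Group K] [TopologicalSpace K] [IsTopologicalGroup K]
    [CompactSpace K] : Prop :=
  ∀ f h : K → ℂ, IsFiniteType K f → IsFiniteType K h →
    (∀ n : ℕ, 1 ≤ n → ∫ k, f k ^ n ∂(normalizedHaar K) = 0) →
    ∃ N : ℕ, ∀ n : ℕ, N ≤ n → ∫ k, f k ^ n * h k ∂(normalizedHaar K) = 0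

/-! ### The complexification -/

/-- `i : K → G` is the (analytic) complexification of the Lie group `K`: every Lie group
homomorphism from `K` to a complex Lie group `H` factors uniquely through `i` by a complex analytic
homomorphism `G → H`. Homomorphisms of Lie groups out of `K` are the continuous homomorphisms
(they are automatically smooth). -/
def IsComplexification {K : Type} [Group K] [TopologicalSpace K]
    (EG : Type) [NormedAddCommGroup EG] [NormedSpace ℂ EG]
    {G : Type} [Group G] [TopologicalSpace G] [ChartedSpace EG G]
    (i : K →ₜ* G) : Prop :=
  ∀ (E : Type) [NormedAddCommGroup E] [NormedSpace ℂ E] [FiniteDimensional ℂ E]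
    (H : Type) [Group H] [TopologicalSpace H] [ChartedSpace E H] [LieGroup 𝓘(ℂ, E) ω H]
    (φ : K →ₜ* H),
    ∃! Φ : G →* H, ContMDiff 𝓘(ℂ, EG) 𝓘(ℂ, E) ω Φ ∧ ∀ k : K, Φ (i k) = φ k

/-! ### The algebra `ℂ[G]` of algebraic functions and its regular representations -/

/-- The algebraic functions on `G`, where `j` realizes `G` as a group of complex `m × m` matrices:
the functions that are polynomials in the matrix entries and the inverse of the determinant. -/
def algebraicFunctions {G : Type} [Group G] {m : ℕ} (j : G →* GL (Fin m) ℂ) :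
    Subalgebra ℂ (G → ℂ) :=
  Algebra.adjoin ℂ
    ({f | ∃ a b : Fin m, f = fun g => (j g : Matrix (Fin m) (Fin m) ℂ) a b} ∪
      {fun g => (Matrix.det (j g : Matrix (Fin m) (Fin m) ℂ))⁻¹})

/-- Precomposition with a self-map of `G`, as an endomorphism of the algebra of functions. -/
def precomp {G : Type} (s : G → G) : (G → ℂ) →ₐ[ℂ] (G → ℂ) where
  toFun f := fun x => f (s x)
  map_one' := rfl
  map_mul' _ _ := rfl
  map_zero' := rfl
  map_add' _ _ := rfl
  commutes' _ := rfl

theorem precomp_mem {G : Type} [Group G] {m : ℕ} (j : G →* GL (Fin m) ℂ) (g h : G)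
    {f : G → ℂ} (hf : f ∈ algebraicFunctions j) :
    (fun x => f (g * x * h)) ∈ algebraicFunctions j := by
  suffices H : algebraicFunctions j ≤
      (algebraicFunctions j).comap (precomp fun x => g * x * h) from H hf
  refine Algebra.adjoin_le ?_
  rintro f (⟨a, b, rfl⟩ | hf)
  · change (fun x => (j (g * x * h) : Matrix (Fin m) (Fin m) ℂ) a b) ∈ algebraicFunctions j
    have : (fun x => (j (g * x * h) : Matrix (Fin m) (Fin m) ℂ) a b) =
        ∑ d : Fin m, ∑ c : Fin m, ((j g : Matrix (Fin m) (Fin m) ℂ) a c *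
          (j h : Matrix (Fin m) (Fin m) ℂ) d b) •
            (fun x => (j x : Matrix (Fin m) (Fin m) ℂ) c d) := by
      funext x
      simp only [map_mul, Units.val_mul, Matrix.mul_apply, Finset.sum_apply, Pi.smul_apply,
        smul_eq_mul, Finset.sum_mul]
      exact Finset.sum_congr rfl fun d _ => Finset.sum_congr rfl fun c _ => by ring
    rw [this]
    refine Subalgebra.sum_mem _ fun d _ => Subalgebra.sum_mem _ fun c _ =>
      Subalgebra.smul_mem _ ?_ _
    exact Algebra.subset_adjoin (Set.mem_union_left _ ⟨c, d, rfl⟩)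
  · rw [Set.mem_singleton_iff] at hf
    subst hf
    change (fun x => (Matrix.det (j (g * x * h) : Matrix (Fin m) (Fin m) ℂ))⁻¹) ∈
      algebraicFunctions j
    have : (fun x => (Matrix.det (j (g * x * h) : Matrix (Fin m) (Fin m) ℂ))⁻¹) =
        ((Matrix.det (j g : Matrix (Fin m) (Fin m) ℂ))⁻¹ *
          (Matrix.det (j h : Matrix (Fin m) (Fin m) ℂ))⁻¹) •
            (fun x => (Matrix.det (j x : Matrix (Fin m) (Fin m) ℂ))⁻¹) := by
      funext x
      simp only [map_mul, Units.val_mul, Matrix.det_mul, Pi.smul_apply, smul_eq_mul, mul_inv]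
      ring
    rw [this]
    refine Subalgebra.smul_mem _ ?_ _
    exact Algebra.subset_adjoin (Set.mem_union_right _ rfl)

/-- The action of `G` on `ℂ[G]` by left translations, `(g · f)(x) = f(g⁻¹ x)`. -/
def leftRegular {G : Type} [Group G] {m : ℕ} (j : G →* GL (Fin m) ℂ) :
    Representation ℂ G (algebraicFunctions j) where
  toFun g :=
    { toFun := fun f => ⟨fun x => f.1 (g⁻¹ * x), by simpa using precomp_mem j g⁻¹ 1 f.2⟩
      map_add' := fun _ _ => rfl
      map_smul' := fun _ _ => rfl }
  map_one' := by ext f x; simp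
  map_mul' g h := by ext f x; simp [mul_assoc]

/-- The action of `G` on `ℂ[G]` by right translations, `(g · f)(x) = f(x g)`. -/
def rightRegular {G : Type} [Group G] {m : ℕ} (j : G →* GL (Fin m) ℂ) :
    Representation ℂ G (algebraicFunctions j) where
  toFun g :=
    { toFun := fun f => ⟨fun x => f.1 (x * g), by simpa using precomp_mem j 1 g f.2⟩
      map_add' := fun _ _ => rfl
      map_smul' := fun _ _ => rfl }
  map_one' := by ext f x; simp
  map_mul' g h := by ext f x; simp [mul_assoc]

/-! ### Isotypical components -/

section Isotypic

variable {G A V : Type*} [Group G] [AddCommGroup A] [Module ℂ A] [AddCommGroup V] [Module ℂ V]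

/-- The `π`-isotypical component of `(ρ, A)`: the sum of all subrepresentations equivalent to `π`
(`π` is meant to be irreducible). -/
def isotypicPart (ρ : Representation ℂ G A) (π : Representation ℂ G V) : Submodule ℂ A :=
  ⨆ W ∈ {W : Subrepresentation ρ | Nonempty (W.toRepresentation.Equiv π)}, W.toSubmodule

/-- The sum of all isotypical components of `(ρ, A)` other than the one of `π`, i.e. of all
finite-dimensional irreducible subrepresentations not equivalent to `π`. -/
def isotypicRest (ρ : Representation ℂ G A) (π : Representation ℂ G V) : Submodule ℂ A :=
  ⨆ W ∈ {W : Subrepresentation ρ | FiniteDimensional ℂ W.toSubmodule ∧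
    W.toRepresentation.IsIrreducible ∧ IsEmpty (W.toRepresentation.Equiv π)}, W.toSubmodule

open Classical in
/-- The projection `f ↦ (f)_π` of `A` onto its `π`-isotypical component, along the sum of the other
isotypical components (and `0` by convention if `A` is not the direct sum of these two). -/
def isotypicProj (ρ : Representation ℂ G A) (π : Representation ℂ G V) : A →ₗ[ℂ] A :=
  if h : IsCompl (isotypicPart ρ π) (isotypicRest ρ π) then Submodule.projection _ _ h else 0

end Isotypic

end

/-! Weyl's unitary trick turns isotypical projections on `ℂ[G]` into integrals over `K`. The image
of `K` is Zariski dense in `G` (`eq_zero_of_restrict_eq_zero`), so `⟨p, q⟩ = ∫_K conj(p) q` is an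
inner product on `ℂ[G]`. It is `K`-invariant because Haar measure is bi-invariant. An orthogonal
projection onto a finite-dimensional subrepresentation therefore commutes with `K`, and then with
`G` (`IsComplexification.commute`): `G` is only known through its universal property, and
conjugating an analytic representation by an operator commuting with `K` gives a second extension of
the same homomorphism on `K`, which must agree with the first.

Equivariant projections and local finiteness give complete reducibility, and by Schur's lemma the
`π`-isotypical component is orthogonal to all the others. Hence `⟨p, (q)_π⟩ = ⟨p, q⟩` for `p` in
that component (`inner_isotypicProj`). With `p = 1` and `π` trivial, the hypothesis on `f` becomes
`∫_K f^n = 0`. The Mathieu Conjecture with test function `conj(p)` then gives `⟨p, f^n⟩ = 0` for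
large `n`. The component is finite-dimensional (`finiteDimensional_isotypicPart`), so one bound
serves every `p` in it, and `(f^n)_π` is orthogonal to itself. -/

/-! ### Isotypical decomposition of locally finite unitarizable representations -/

section IsotypicDecomposition

variable {G A V : Type*} [Group G] [NormedAddCommGroup A] [InnerProductSpace ℂ A]
  [AddCommGroup V] [Module ℂ V] {ρ : Representation ℂ G A} {π : Representation ℂ G V}

/-- Every vector lies in a finite-dimensional subrepresentation. -/
def Representation.LocallyFinite {G A : Type*} [Group G] [AddCommGroup A] [Module ℂ A]
    (ρ : Representation ℂ G A) : Prop :=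
  ∀ a : A, ∃ U : Subrepresentation ρ, FiniteDimensional ℂ U.toSubmodule ∧ a ∈ U.toSubmodule

/-- Orthogonal projections onto finite-dimensional subrepresentations are equivariant. -/
def Representation.ProjectionsEquivariant (ρ : Representation ℂ G A) : Prop :=
  ∀ (W : Subrepresentation ρ) [FiniteDimensional ℂ W.toSubmodule] (g : G) (a : A),
    W.toSubmodule.starProjection (ρ g a) = ρ g (W.toSubmodule.starProjection a)

open Representation

/-- Schur's lemma: the orthogonal projection to `W`, restricted to `W'` and followed by `e`,
intertwines two inequivalent irreducible representations, so it vanishes. -/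
theorem isOrtho_of_equiv_of_isEmpty_equiv (hq : ProjectionsEquivariant ρ)
    (W W' : Subrepresentation ρ) [FiniteDimensional ℂ W.toSubmodule] (hπ : π.IsIrreducible)
    (e : W.toRepresentation.Equiv π) (hW' : W'.toRepresentation.IsIrreducible)
    (h : IsEmpty (W'.toRepresentation.Equiv π)) :
    W.toSubmodule ⟂ W'.toSubmodule := by
  let T : W'.toRepresentation.IntertwiningMap π := e.toIntertwiningMap.comp
    (LinearMap.intertwiningMap_of_isIntertwiningMap _ _
      (W.toSubmodule.orthogonalProjectionOnto.toLinearMap ∘ₗ W'.toSubmodule.subtype)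
      (fun g v => Subtype.ext (hq W g v)))
  have hT : T = 0 := (Representation.IsIrreducible.bijective_or_eq_zero T).resolve_left
    fun hb => h.false (T.ofBijective hb)
  rw [Submodule.isOrtho_comm, Submodule.isOrtho_iff_le]
  intro w hw
  rw [← Submodule.orthogonalProjectionOnto_eq_zero_iff]
  exact (map_eq_zero_iff _ e.toLinearEquiv.injective).1
    (congrArg (fun S : W'.toRepresentation.IntertwiningMap π => S ⟨w, hw⟩) hT)

theorem isotypicPart_isOrtho_isotypicRest [FiniteDimensional ℂ V] (hq : ProjectionsEquivariant ρ)
    (hπ : π.IsIrreducible) : isotypicPart ρ π ⟂ isotypicRest ρ π := by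
  simp only [isotypicPart, isotypicRest, Submodule.isOrtho_iSup_left, Submodule.isOrtho_iSup_right]
  intro W' hW' W hW
  obtain ⟨e⟩ : Nonempty (W.toRepresentation.Equiv π) := hW
  have : FiniteDimensional ℂ W.toSubmodule := e.toLinearEquiv.symm.finiteDimensional
  exact isOrtho_of_equiv_of_isEmpty_equiv hq W W' hπ e hW'.2.1 hW'.2.2

theorem Subrepresentation.exists_lt_of_not_isIrreducible {G A : Type*} [Group G] [AddCommGroup A]
    [Module ℂ A] {ρ : Representation ℂ G A} (U : Subrepresentation ρ)
    (hU : ¬ U.toRepresentation.IsIrreducible) (h0 : U.toSubmodule ≠ ⊥) :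
    ∃ S : Subrepresentation ρ, S.toSubmodule < U.toSubmodule ∧ S.toSubmodule ≠ ⊥ := by
  by_contra! H
  have hinj := Submodule.map_injective_of_injective U.toSubmodule.injective_subtype
  refine hU { exists_pair_ne := ⟨⊥, ⊤, fun h => h0 ?_⟩, eq_bot_or_eq_top := fun S => ?_ }
  · have h' : (⊥ : Submodule ℂ U.toSubmodule) = ⊤ := congrArg Subrepresentation.toSubmodule h
    have := congrArg (Submodule.map U.toSubmodule.subtype) h'
    simpa using this.symm
  · let S' : Subrepresentation ρ :=
      { toSubmodule := S.toSubmodule.map U.toSubmodule.subtype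
        apply_mem_toSubmodule := by
          rintro g _ ⟨v, hv, rfl⟩
          exact ⟨_, S.apply_mem_toSubmodule g hv, rfl⟩ }
    by_cases hS : S'.toSubmodule < U.toSubmodule
    · left
      apply Subrepresentation.toSubmodule_injective
      apply hinj
      exact (H S' hS).trans (Submodule.map_bot _).symm
    · right
      apply Subrepresentation.toSubmodule_injective
      apply hinj
      have hle : S'.toSubmodule ≤ U.toSubmodule := Submodule.map_subtype_le _ _
      exact ((eq_of_le_of_not_lt hle hS)).trans (Submodule.map_subtype_top _).symm

/-- Complete reducibility by induction on dimension. A proper nonzero subrepresentation `S` splits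
off `U`, because the kernel of an equivariant projection is invariant. -/
theorem Subrepresentation.le_isotypicPart_sup_isotypicRest (hq : ProjectionsEquivariant ρ)
    (n : ℕ) (U : Subrepresentation ρ) [FiniteDimensional ℂ U.toSubmodule]
    (hn : Module.finrank ℂ U.toSubmodule = n) :
    U.toSubmodule ≤ isotypicPart ρ π ⊔ isotypicRest ρ π := by
  induction n using Nat.strong_induction_on generalizing U with
  | _ n ih =>
  by_cases hirr : U.toRepresentation.IsIrreducible
  · by_cases he : Nonempty (U.toRepresentation.Equiv π)
    · exact le_sup_of_le_left (le_iSup₂_of_le U he le_rfl)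
    · exact le_sup_of_le_right (le_iSup₂_of_le U ⟨‹_›, hirr, not_nonempty_iff.1 he⟩ le_rfl)
  by_cases h0 : U.toSubmodule = ⊥
  · simp [h0]
  obtain ⟨S, hS, hS'⟩ := U.exists_lt_of_not_isIrreducible hirr h0
  have : FiniteDimensional ℂ S.toSubmodule := Submodule.finiteDimensional_of_le hS.le
  let C : Subrepresentation ρ :=
    { toSubmodule := S.toSubmoduleᗮ ⊓ U.toSubmodule
      apply_mem_toSubmodule := by
        rintro g v ⟨hv, hv'⟩
        refine ⟨?_, U.apply_mem_toSubmodule g hv'⟩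
        rw [SetLike.mem_coe, ← Submodule.starProjection_apply_eq_zero_iff] at hv ⊢
        rw [hq, hv, map_zero] }
  have hC : C.toSubmodule < U.toSubmodule := by
    refine lt_of_le_of_ne inf_le_right fun h => hS' ?_
    exact Submodule.isOrtho_self.1 (hS.le.trans (inf_eq_right.1 h))
  have : FiniteDimensional ℂ C.toSubmodule := Submodule.finiteDimensional_of_le hC.le
  have hsup : S.toSubmodule ⊔ C.toSubmodule = U.toSubmodule :=
    Submodule.sup_orthogonal_inf_of_hasOrthogonalProjection hS.le
  rw [← hsup]
  exact sup_le (ih _ (hn ▸ Submodule.finrank_lt_finrank_of_lt hS) S rfl)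
    (ih _ (hn ▸ Submodule.finrank_lt_finrank_of_lt hC) C rfl)

theorem isCompl_isotypicPart_isotypicRest [FiniteDimensional ℂ V] (hq : ProjectionsEquivariant ρ)
    (hlf : LocallyFinite ρ) (hπ : π.IsIrreducible) :
    IsCompl (isotypicPart ρ π) (isotypicRest ρ π) := by
  refine ⟨(isotypicPart_isOrtho_isotypicRest hq hπ).disjoint, codisjoint_iff.2 ?_⟩
  refine eq_top_iff.2 fun a _ => ?_
  obtain ⟨U, hU, ha⟩ := hlf a
  exact U.le_isotypicPart_sup_isotypicRest hq _ rfl ha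

theorem isotypicProj_mem {G A V : Type*} [Group G] [AddCommGroup A] [Module ℂ A]
    [AddCommGroup V] [Module ℂ V] (ρ : Representation ℂ G A) (π : Representation ℂ G V) (a : A) :
    isotypicProj ρ π a ∈ isotypicPart ρ π := by
  unfold isotypicProj
  split_ifs with h
  · exact Submodule.projection_apply_mem h a
  · simp

/-- The discarded part of `a` is orthogonal to `p`. This translates statements about `(·)_π` into
inner products. -/
theorem inner_isotypicProj [FiniteDimensional ℂ V] (hq : ProjectionsEquivariant ρ)
    (hlf : LocallyFinite ρ) (hπ : π.IsIrreducible) {p : A} (hp : p ∈ isotypicPart ρ π) (a : A) :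
    inner ℂ p (isotypicProj ρ π a) = inner ℂ p a := by
  have hc := isCompl_isotypicPart_isotypicRest hq hlf hπ
  have hort : inner ℂ p (Submodule.projection _ _ hc.symm a) = 0 :=
    (isotypicPart_isOrtho_isotypicRest hq hπ).inner_eq hp (Submodule.projection_apply_mem _ _)
  rw [isotypicProj, dif_pos hc]
  conv_rhs => rw [← Submodule.projection_add_projection_eq_self hc a, inner_add_right, hort,
    add_zero]

end IsotypicDecomposition

/-! ### Haar measure on a compact group -/

section CompactGroup

open MeasureTheory

variable {K : Type*} [Group K] [TopologicalSpace K] [IsTopologicalGroup K] [CompactSpace K]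
  [MeasurableSpace K] [BorelSpace K] (μ : Measure K) [μ.IsHaarMeasure] [IsProbabilityMeasure μ]

/-- A right translate of `μ` is again a Haar probability measure, and such a measure is unique. -/
theorem isMulRightInvariant_of_compactSpace : μ.IsMulRightInvariant where
  map_mul_right_eq_self g := by
    have : IsProbabilityMeasure (μ.map (· * g)) :=
      Measure.isProbabilityMeasure_map (measurable_mul_const g).aemeasurable
    have : (μ.map (· * g)).IsHaarMeasure :=
      { toIsMulLeftInvariant := inferInstance
        toIsOpenPosMeasure :=
          (continuous_mul_const g).isOpenPosMeasure_map (mul_right_surjective g) }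
    exact Measure.isHaarMeasure_eq_of_isProbabilityMeasure _ _

theorem Continuous.integrable_of_compactSpace {X : Type*} [TopologicalSpace X] [CompactSpace X]
    [MeasurableSpace X] [BorelSpace X] (μ : Measure X) [IsFiniteMeasureOnCompacts μ]
    {E : Type*} [NormedAddCommGroup E]
    {f : X → E} (hf : Continuous f) : Integrable f μ :=
  hf.integrable_of_hasCompactSupport (HasCompactSupport.of_compactSpace f)

/-- Averaging over a compact group: an operator onto an invariant subspace can be replaced by an
equivariant one. -/
theorem exists_commute_of_mul_mul_eq {K : Type*} [Group K] [TopologicalSpace K]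
    [IsTopologicalGroup K] [CompactSpace K] {R : Type*} [NormedRing R] [NormedAlgebra ℂ R]
    [CompleteSpace R] (σ : K →* R) (hσ : Continuous σ) (P : R)
    (hP : ∀ k, P * σ k * P = σ k * P) :
    ∃ T : R, (∀ k, Commute (σ k) T) ∧ P * T = T ∧ T * P = P := by
  let _ : MeasurableSpace K := borel K
  have : BorelSpace K := ⟨rfl⟩
  let μ : Measure K := Measure.haarMeasure (⊤ : TopologicalSpace.PositiveCompacts K)
  have : IsProbabilityMeasure μ := ⟨Measure.haarMeasure_self⟩
  have hc : Continuous fun k => σ k * P * σ k⁻¹ := by fun_prop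
  have hi := hc.integrable_of_compactSpace μ
  have hinv : ∀ k, σ k⁻¹ * σ k = 1 := fun k => by rw [← map_mul, inv_mul_cancel, map_one]
  have hinv' : ∀ k, σ k * σ k⁻¹ = 1 := fun k => by rw [← map_mul, mul_inv_cancel, map_one]
  -- `T` is the mean of the conjugates of `P`. By `hP`, each conjugate has values in the image of
  -- `P` and acts as the identity there, which gives the last two identities.
  refine ⟨∫ k, σ k * P * σ k⁻¹ ∂μ, fun k' => ?_, ?_, ?_⟩
  · have h1 : σ k' * (∫ k, σ k * P * σ k⁻¹ ∂μ) * σ k'⁻¹ = ∫ k, σ k * P * σ k⁻¹ ∂μ := by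
      conv_rhs => rw [← integral_mul_left_eq_self _ k']
      rw [← integral_const_mul_of_integrable hi,
        ← integral_mul_const_of_integrable (hi.const_mul _)]
      simp only [map_mul, mul_inv_rev, mul_assoc]
    calc σ k' * (∫ k, σ k * P * σ k⁻¹ ∂μ)
        = σ k' * (∫ k, σ k * P * σ k⁻¹ ∂μ) * (σ k'⁻¹ * σ k') := by rw [hinv, mul_one]
      _ = _ := by rw [← mul_assoc, h1]
  · rw [← integral_const_mul_of_integrable hi]
    simp only [← mul_assoc, hP]
  · rw [← integral_mul_const_of_integrable hi]
    have : ∀ k, σ k * P * σ k⁻¹ * P = P := fun k => by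
      rw [mul_assoc, mul_assoc, ← mul_assoc P, hP, ← mul_assoc, hinv', one_mul]
    simp [this]

end CompactGroup

/-! ### Representations of the complexification -/

section Complexification

variable {K : Type} [Group K] [TopologicalSpace K]
  {EG : Type} [NormedAddCommGroup EG] [NormedSpace ℂ EG]
  {G : Type} [Group G] [TopologicalSpace G] [ChartedSpace EG G]
  {i : K →ₜ* G}

/-- An element commuting with the image of `K` under an analytic representation of the
complexification `G` commutes with the image of `G`. -/
theorem IsComplexification.commute (hi : IsComplexification EG i)
    {R : Type} [NormedRing R] [NormedAlgebra ℂ R] [FiniteDimensional ℂ R]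
    (σ : G →* R) (hσ : ContMDiff 𝓘(ℂ, EG) 𝓘(ℂ, R) ω σ) (T : R)
    (hT : ∀ k, Commute (σ (i k)) T) (g : G) : Commute (σ g) T := by
  have : CompleteSpace R := FiniteDimensional.complete ℂ R
  -- Subtracting `T` from a scalar beyond its spectrum yields a unit with the same commutant, so
  -- conjugation by it makes sense.
  obtain ⟨u, c, hu⟩ : ∃ (u : Rˣ) (c : ℂ), (u : R) = algebraMap ℂ R c - T := by
    have hc : ‖T‖ * ‖(1 : R)‖ < ‖((‖T‖ * ‖(1 : R)‖ + 1 : ℝ) : ℂ)‖ := by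
      rw [Complex.norm_real, Real.norm_of_nonneg (by positivity)]
      linarith
    obtain ⟨u, hu⟩ := spectrum.mem_resolventSet_of_norm_lt_mul hc
    exact ⟨u, _, hu⟩
  have hcomm : ∀ x : R, Commute x T ↔ Commute x u := by
    intro x
    rw [hu]
    have h := (Algebra.commutes c x).symm
    refine ⟨fun h' => Commute.sub_right h h', fun h' => ?_⟩
    simpa using Commute.sub_right h h'
  let Φ : G →* Rˣ := σ.toHomUnits
  have hΦ : ContMDiff 𝓘(ℂ, EG) 𝓘(ℂ, R) ω Φ :=
    ContMDiff.of_comp_isOpenEmbedding Units.isOpenEmbedding_val hσ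
  let Ψ : G →* Rˣ := (MulAut.conj u).toMonoidHom.comp Φ
  have hΨ : ContMDiff 𝓘(ℂ, EG) 𝓘(ℂ, R) ω Ψ :=
    (contMDiff_const.mul hΦ).mul contMDiff_const
  have hΦi : ∀ k, Ψ (i k) = Φ (i k) := fun k => by
    have h : (Φ (i k) : R) * u = u * Φ (i k) := (hcomm _).1 (hT k)
    change u * Φ (i k) * u⁻¹ = Φ (i k)
    rw [mul_inv_eq_iff_eq_mul]
    exact Units.ext h.symm
  -- `Φ` and its conjugate `Ψ` agree on `K`, so the uniqueness clause, with target the complex Lie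
  -- group `Rˣ`, forces `Ψ = Φ`.
  obtain ⟨_, _, huniq⟩ := hi R Rˣ ⟨Φ.comp i.toMonoidHom, hΦ.continuous.comp i.continuous_toFun⟩
  have hΦΨ : Ψ = Φ := (huniq Ψ ⟨hΨ, hΦi⟩).trans (huniq Φ ⟨hΦ, fun _ => rfl⟩).symm
  have h1 : u * Φ g * u⁻¹ = Φ g := congrArg (fun f : G →* Rˣ => f g) hΦΨ
  rw [mul_inv_eq_iff_eq_mul] at h1
  exact (hcomm _).2 (congrArg Units.val h1).symm

/-- Subspaces invariant under `K` are invariant under the complexification `G`, formulated for the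
projection `P` onto the subspace. -/
theorem IsComplexification.mul_mul_eq [IsTopologicalGroup K] [CompactSpace K]
    (hi : IsComplexification EG i)
    {R : Type} [NormedRing R] [NormedAlgebra ℂ R] [FiniteDimensional ℂ R]
    (σ : G →* R) (hσ : ContMDiff 𝓘(ℂ, EG) 𝓘(ℂ, R) ω σ) (P : R)
    (hP : ∀ k, P * σ (i k) * P = σ (i k) * P) (g : G) : P * σ g * P = σ g * P := by
  have : CompleteSpace R := FiniteDimensional.complete ℂ R
  obtain ⟨T, hT, hPT, hTP⟩ := exists_commute_of_mul_mul_eq (σ.comp i.toMonoidHom)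
    (hσ.continuous.comp i.continuous_toFun) P hP
  have h := hi.commute σ hσ T hT g
  -- `T` has the same image as `P` and commutes with all of `G`, so this image is `G`-invariant.
  calc P * σ g * P = P * (σ g * T) * P := by rw [mul_assoc, mul_assoc, mul_assoc, hTP]
    _ = (P * T) * σ g * P := by rw [h.eq, mul_assoc P T]
    _ = σ g * P := by rw [hPT, ← h.eq, mul_assoc, hTP]

/-- A representation of a complex Lie group with analytic matrix coefficients. -/
def Representation.IsAnalytic {U : Type*} [AddCommGroup U] [Module ℂ U] (EG : Type)
    [NormedAddCommGroup EG] [NormedSpace ℂ EG] [ChartedSpace EG G]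
    (σ : Representation ℂ G U) : Prop :=
  ∀ (u : U) (l : Module.Dual ℂ U), ContMDiff 𝓘(ℂ, EG) 𝓘(ℂ, ℂ) ω fun g => l (σ g u)

/-! ### Transfer to finite-dimensional representations without a chosen norm -/

section Linear

variable {U : Type} [AddCommGroup U] [Module ℂ U] [FiniteDimensional ℂ U]
  {σ : Representation ℂ G U}

/-- Endomorphisms of a finite-dimensional space as elements of a normed algebra. -/
noncomputable def endAlgEquivCLM (U : Type) [AddCommGroup U] [Module ℂ U] [FiniteDimensional ℂ U] :
    Module.End ℂ U ≃ₐ[ℂ] ((Fin (Module.finrank ℂ U) → ℂ) →L[ℂ] (Fin (Module.finrank ℂ U) → ℂ)) :=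
  ((Module.finBasis ℂ U).equivFun.conjAlgEquiv ℂ).trans
    (Module.End.toContinuousLinearMap (Fin (Module.finrank ℂ U) → ℂ))

/-- A finite-dimensional representation as a homomorphism to a normed algebra. -/
noncomputable def Representation.toCLM (σ : Representation ℂ G U) :
    G →* ((Fin (Module.finrank ℂ U) → ℂ) →L[ℂ] (Fin (Module.finrank ℂ U) → ℂ)) where
  toFun g := endAlgEquivCLM U (σ g)
  map_one' := by rw [map_one, map_one]
  map_mul' g h := by rw [map_mul, map_mul]

theorem Representation.IsAnalytic.contMDiff_toCLM (hσ : σ.IsAnalytic EG) :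
    ContMDiff 𝓘(ℂ, EG)
      𝓘(ℂ, (Fin (Module.finrank ℂ U) → ℂ) →L[ℂ] (Fin (Module.finrank ℂ U) → ℂ)) ω σ.toCLM := by
  let b := Module.finBasis ℂ U
  have : ∀ g, endAlgEquivCLM U (σ g) = ∑ c, ∑ d, b.coord c (σ g (b d)) •
      endAlgEquivCLM U ((LinearMap.toMatrixAlgEquiv b).symm (Matrix.single c d (1 : ℂ))) := by
    intro g
    conv_lhs => rw [← (LinearMap.toMatrixAlgEquiv b).symm_apply_apply (σ g),
      Matrix.matrix_eq_sum_single (LinearMap.toMatrixAlgEquiv b (σ g))]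
    simp only [map_sum, LinearMap.toMatrixAlgEquiv_apply, ← map_smul, Matrix.smul_single,
      smul_eq_mul, mul_one, Module.Basis.coord_apply]
  refine ContMDiff.congr ?_ this
  exact contMDiff_finsetSum fun a _ => contMDiff_finsetSum fun b _ =>
    (hσ _ _).smul contMDiff_const

theorem IsComplexification.commute_linear (hi : IsComplexification EG i) (hσ : σ.IsAnalytic EG)
    (T : Module.End ℂ U) (hT : ∀ k u, σ (i k) (T u) = T (σ (i k) u)) (g : G) (u : U) :
    σ g (T u) = T (σ g u) := by
  have h := hi.commute _ (Representation.IsAnalytic.contMDiff_toCLM hσ) (endAlgEquivCLM U T) (fun k => by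
    have : Commute (σ (i k)) T := LinearMap.ext (hT k)
    exact this.map (endAlgEquivCLM U)) g
  have h' : endAlgEquivCLM U (σ g * T) = endAlgEquivCLM U (T * σ g) := by
    rw [map_mul, map_mul]
    exact h.eq
  exact LinearMap.congr_fun ((endAlgEquivCLM U).injective h') u

theorem IsComplexification.apply_mem_of_forall_apply_mem [IsTopologicalGroup K] [CompactSpace K]
    (hi : IsComplexification EG i) (hσ : σ.IsAnalytic EG) (W : Submodule ℂ U)
    (hW : ∀ k, ∀ w ∈ W, σ (i k) w ∈ W) (g : G) {w : U} (hw : w ∈ W) : σ g w ∈ W := by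
  obtain ⟨C, hC⟩ := W.exists_isCompl
  let P : Module.End ℂ U := W.projection C hC
  -- Invariance of `W` as an algebraic identity in a projection onto it; any complement `C` will do.
  have hP : ∀ T : Module.End ℂ U, P * T * P = T * P ↔ ∀ w ∈ W, T w ∈ W := by
    intro T
    constructor
    · intro h w hw
      have := LinearMap.congr_fun h w
      have hPw : P w = w := Submodule.projection_apply_of_mem_left hC hw
      simp only [Module.End.mul_apply, hPw] at this
      rw [← this]
      exact Submodule.projection_apply_mem hC _
    · intro h
      ext u
      exact Submodule.projection_apply_of_mem_left hC (h _ (Submodule.projection_apply_mem hC _))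
  refine (hP (σ g)).1 ?_ w hw
  apply (endAlgEquivCLM U).injective
  rw [map_mul, map_mul, map_mul]
  refine hi.mul_mul_eq _ (Representation.IsAnalytic.contMDiff_toCLM hσ) (endAlgEquivCLM U P) (fun k => ?_) g
  have := congrArg (endAlgEquivCLM U) ((hP (σ (i k))).2 (hW k))
  rwa [map_mul, map_mul, map_mul] at this

end Linear

end Complexification

/-! ### Algebraic functions -/

section DualSpan

/-- The common kernel of the functionals is zero, so in finite dimension they span the dual.
Regularity of all matrix coefficients thus reduces to that of point evaluations. -/
theorem mem_span_range_dual {X U : Type*} [AddCommGroup U] [Module ℂ U] [FiniteDimensional ℂ U]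
    (ev : X → Module.Dual ℂ U) (hev : ∀ u, (∀ x, ev x u = 0) → u = 0) (l : Module.Dual ℂ U) :
    l ∈ Submodule.span ℂ (Set.range ev) := by
  rw [← Subspace.dualCoannihilator_dualAnnihilator_eq (W := Submodule.span ℂ (Set.range ev))]
  have : (Submodule.span ℂ (Set.range ev)).dualCoannihilator = ⊥ := by
    refine (Submodule.eq_bot_iff _).2 fun u hu => hev u fun x => ?_
    exact (Submodule.mem_dualCoannihilator _).1 hu _ (Submodule.subset_span ⟨x, rfl⟩)
  rw [this, Submodule.dualAnnihilator_bot]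
  trivial

theorem Representation.isAnalytic_of_separating {G : Type} [Group G] [TopologicalSpace G]
    {EG : Type} [NormedAddCommGroup EG] [NormedSpace ℂ EG] [ChartedSpace EG G]
    {X U : Type*} [AddCommGroup U] [Module ℂ U] [FiniteDimensional ℂ U]
    {σ : Representation ℂ G U} (ev : X → Module.Dual ℂ U) (hev : ∀ u, (∀ x, ev x u = 0) → u = 0)
    (h : ∀ x u, ContMDiff 𝓘(ℂ, EG) 𝓘(ℂ, ℂ) ω fun g => ev x (σ g u)) : σ.IsAnalytic EG := by
  intro u l
  have hl := mem_span_range_dual ev hev l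
  induction hl using Submodule.span_induction with
  | mem l hl =>
    obtain ⟨x, rfl⟩ := hl
    exact h x u
  | zero => exact contMDiff_const
  | add l l' _ _ ih ih' => exact ih.add ih'
  | smul c l _ ih => exact contMDiff_const.mul ih

end DualSpan

section AlgebraicFunctions

variable {G : Type} [Group G] {m : ℕ} (j : G →* GL (Fin m) ℂ)

/-- The two-sided translation `f ↦ f (g * · * h)` of algebraic functions. -/
noncomputable def twoSidedTranslation (g h : G) : algebraicFunctions j →ₐ[ℂ] algebraicFunctions j :=
  ((precomp fun x => g * x * h).comp (algebraicFunctions j).val).codRestrict _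
    fun f => precomp_mem j g h f.2

@[simp]
theorem twoSidedTranslation_apply (g h x : G) (f : algebraicFunctions j) :
    (twoSidedTranslation j g h f).1 x = f.1 (g * x * h) := rfl

theorem leftRegular_apply (g : G) (f : algebraicFunctions j) :
    leftRegular j g f = twoSidedTranslation j g⁻¹ 1 f := by
  ext x; simp [leftRegular]

theorem rightRegular_apply (g : G) (f : algebraicFunctions j) :
    rightRegular j g f = twoSidedTranslation j 1 g f := by
  ext x; simp [rightRegular]

/-- Algebraic functions are locally finite under two-sided translations. -/
theorem exists_twoSided_invariant (f : algebraicFunctions j) :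
    ∃ U : Submodule ℂ (algebraicFunctions j), U.FG ∧ f ∈ U ∧
      ∀ g h, ∀ u ∈ U, twoSidedTranslation j g h u ∈ U := by
  obtain ⟨f, hf⟩ := f
  induction hf using Algebra.adjoin_induction with
  | mem f hf =>
    have hspan : ∀ (S : Set (algebraicFunctions j)),
        (∀ g h, ∀ u ∈ S, twoSidedTranslation j g h u ∈ Submodule.span ℂ S) →
        ∀ g h, ∀ u ∈ Submodule.span ℂ S, twoSidedTranslation j g h u ∈ Submodule.span ℂ S := by
      intro S hS g h
      exact Submodule.span_le (p := (Submodule.span ℂ S).comap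
        (twoSidedTranslation j g h).toLinearMap) |>.2 (hS g h)
    rcases hf with ⟨a, b, rfl⟩ | hf
    · let e : Fin m × Fin m → algebraicFunctions j := fun p =>
        ⟨fun g => (j g : Matrix (Fin m) (Fin m) ℂ) p.1 p.2,
          Algebra.subset_adjoin (Set.mem_union_left _ ⟨p.1, p.2, rfl⟩)⟩
      refine ⟨Submodule.span ℂ (Set.range e), Submodule.fg_span (Set.finite_range e),
        Submodule.subset_span ⟨(a, b), rfl⟩, hspan _ ?_⟩
      rintro g h _ ⟨⟨a, b⟩, rfl⟩
      have : twoSidedTranslation j g h (e (a, b)) =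
          ∑ d : Fin m, ∑ c : Fin m, ((j g : Matrix (Fin m) (Fin m) ℂ) a c *
            (j h : Matrix (Fin m) (Fin m) ℂ) d b) • e (c, d) := by
        ext x
        simp only [twoSidedTranslation_apply, e, map_mul, Units.val_mul, Matrix.mul_apply,
          AddSubmonoidClass.coe_finsetSum, Finset.sum_apply, SetLike.val_smul, Pi.smul_apply,
          smul_eq_mul, Finset.sum_mul]
        exact Finset.sum_congr rfl fun d _ => Finset.sum_congr rfl fun c _ => by ring
      rw [this]
      exact Submodule.sum_mem _ fun d _ => Submodule.sum_mem _ fun c _ =>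
        Submodule.smul_mem _ _ (Submodule.subset_span ⟨_, rfl⟩)
    · refine ⟨Submodule.span ℂ {⟨f, Algebra.subset_adjoin (Set.mem_union_right _ hf)⟩},
        Submodule.fg_span_singleton _, Submodule.mem_span_singleton_self _, hspan _ ?_⟩
      rintro g h _ rfl
      rw [Set.mem_singleton_iff] at hf
      subst hf
      refine Submodule.mem_span_singleton.2 ⟨(Matrix.det (j g : Matrix (Fin m) (Fin m) ℂ))⁻¹ *
          (Matrix.det (j h : Matrix (Fin m) (Fin m) ℂ))⁻¹, ?_⟩
      ext x
      simp only [twoSidedTranslation_apply, map_mul, Units.val_mul, Matrix.det_mul,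
        SetLike.val_smul, Pi.smul_apply, smul_eq_mul, mul_inv]
      ring
  | algebraMap r =>
    refine ⟨Submodule.span ℂ {1}, Submodule.fg_span_singleton _,
      Submodule.mem_span_singleton.2 ⟨r, ?_⟩, fun g h u hu => ?_⟩
    · ext x; simp
    · obtain ⟨c, rfl⟩ := Submodule.mem_span_singleton.1 hu
      rw [map_smul, map_one]
      exact Submodule.smul_mem _ _ (Submodule.mem_span_singleton_self _)
  | add f f' hf hf' ih ih' =>
    obtain ⟨U, hU, hfU, hUi⟩ := ih
    obtain ⟨U', hU', hfU', hUi'⟩ := ih'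
    refine ⟨U ⊔ U', hU.sup hU', Submodule.add_mem_sup hfU hfU', fun g h => ?_⟩
    exact sup_le (a := U) (b := U')
      (c := (U ⊔ U').comap (twoSidedTranslation j g h).toLinearMap)
      (fun u hu => Submodule.mem_sup_left (hUi g h u hu))
      (fun u hu => Submodule.mem_sup_right (hUi' g h u hu))
  | mul f f' hf hf' ih ih' =>
    obtain ⟨U, hU, hfU, hUi⟩ := ih
    obtain ⟨U', hU', hfU', hUi'⟩ := ih'
    -- Translations are algebra homomorphisms, so the product of invariant subspaces is invariant.
    refine ⟨U * U', hU.mul hU', Submodule.mul_mem_mul hfU hfU', fun g h => ?_⟩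
    refine Submodule.mul_le (P := (U * U').comap (twoSidedTranslation j g h).toLinearMap) |>.2
      fun u hu v hv => ?_
    change twoSidedTranslation j g h (u * v) ∈ U * U'
    rw [map_mul]
    exact Submodule.mul_mem_mul (hUi g h u hu) (hUi' g h v hv)

section Analytic

variable {j} {EG : Type} [NormedAddCommGroup EG] [NormedSpace ℂ EG]
  [TopologicalSpace G] [ChartedSpace EG G]

theorem contMDiff_of_mem_algebraicFunctions
    (hj : ∀ a b : Fin m, ContMDiff 𝓘(ℂ, EG) 𝓘(ℂ, ℂ) ω
      (fun g => (j g : Matrix (Fin m) (Fin m) ℂ) a b)) {f : G → ℂ} (hf : f ∈ algebraicFunctions j) :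
    ContMDiff 𝓘(ℂ, EG) 𝓘(ℂ, ℂ) ω f := by
  induction hf using Algebra.adjoin_induction with
  | mem f hf =>
    rcases hf with ⟨a, b, rfl⟩ | hf
    · exact hj a b
    · rw [Set.mem_singleton_iff] at hf
      subst hf
      refine ContMDiff.inv₀ ?_ fun g => (Matrix.isUnit_iff_isUnit_det _).1 (j g).isUnit |>.ne_zero
      simp only [Matrix.det_apply]
      refine contMDiff_finsetSum fun σ _ => ?_
      simp only [Units.smul_def, zsmul_eq_mul]
      exact contMDiff_const.mul (contMDiff_finsetProd fun a _ => hj _ _)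
  | algebraMap r => exact contMDiff_const
  | add f f' _ _ ih ih' => exact ih.add ih'
  | mul f f' _ _ ih ih' => exact ih.mul ih'

end Analytic

end AlgebraicFunctions

/-! ### Regular representations -/

section Regular

variable {G : Type} [Group G] {m : ℕ} {j : G →* GL (Fin m) ℂ}
  {ρ : Representation ℂ G (algebraicFunctions j)}

theorem locallyFinite_of_regular (hρ : ρ = leftRegular j ∨ ρ = rightRegular j) :
    ρ.LocallyFinite := by
  intro f
  obtain ⟨U, hU, hf, hUi⟩ := exists_twoSided_invariant j f
  refine ⟨⟨U, fun g u hu => ?_⟩, Module.Finite.iff_fg.2 hU, hf⟩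
  rcases hρ with rfl | rfl
  · rw [leftRegular_apply]; exact hUi _ _ u hu
  · rw [rightRegular_apply]; exact hUi _ _ u hu

/-- Evaluation at `1` recovers a function from its translates, which exhibits it as a matrix
coefficient of `ρ`, whichever side acts. -/
theorem exists_apply_eq_apply_one (hρ : ρ = leftRegular j ∨ ρ = rightRegular j) :
    ∃ s : G → G, ∀ (f : algebraicFunctions j) x, f.1 x = (ρ (s x) f).1 1 := by
  rcases hρ with rfl | rfl
  · exact ⟨fun x => x⁻¹, fun f x => by simp [leftRegular_apply]⟩
  · exact ⟨fun x => x, fun f x => by simp [rightRegular_apply]⟩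

theorem regular_one (hρ : ρ = leftRegular j ∨ ρ = rightRegular j) (g : G) : ρ g 1 = 1 := by
  rcases hρ with rfl | rfl
  · rw [leftRegular_apply, map_one]
  · rw [rightRegular_apply, map_one]

variable {K : Type} [Group K] [TopologicalSpace K] [IsTopologicalGroup K] [CompactSpace K]
  {EG : Type} [NormedAddCommGroup EG] [NormedSpace ℂ EG]
  [TopologicalSpace G] [ChartedSpace EG G] [LieGroup 𝓘(ℂ, EG) ω G] {i : K →ₜ* G}

theorem contMDiff_regular_apply (hj : ∀ a b : Fin m, ContMDiff 𝓘(ℂ, EG) 𝓘(ℂ, ℂ) ω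
      (fun g => (j g : Matrix (Fin m) (Fin m) ℂ) a b))
    (hρ : ρ = leftRegular j ∨ ρ = rightRegular j) (f : algebraicFunctions j) (x : G) :
    ContMDiff 𝓘(ℂ, EG) 𝓘(ℂ, ℂ) ω fun g => (ρ g f).1 x := by
  have hf := contMDiff_of_mem_algebraicFunctions hj f.2
  rcases hρ with rfl | rfl
  · exact hf.comp ((contMDiff_inv 𝓘(ℂ, EG) ω).mul contMDiff_const)
  · exact hf.comp (contMDiff_const.mul contMDiff_id)

theorem isAnalytic_toRepresentation (hj : ∀ a b : Fin m, ContMDiff 𝓘(ℂ, EG) 𝓘(ℂ, ℂ) ω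
      (fun g => (j g : Matrix (Fin m) (Fin m) ℂ) a b))
    (hρ : ρ = leftRegular j ∨ ρ = rightRegular j) (U : Subrepresentation ρ)
    [FiniteDimensional ℂ U.toSubmodule] :
    Representation.IsAnalytic (G := G) (U := U.toSubmodule) EG U.toRepresentation :=
  Representation.isAnalytic_of_separating (G := G) (U := U.toSubmodule)
    (fun x : G => LinearMap.proj x ∘ₗ (algebraicFunctions j).val.toLinearMap ∘ₗ
      U.toSubmodule.subtype)
    (fun _ hu => Subtype.ext (Subtype.ext (funext hu)))
    (fun x u => contMDiff_regular_apply hj hρ u.1 x)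

theorem regular_apply_restrict {K : Type} [Group K] [TopologicalSpace K]
    (hρ : ρ = leftRegular j ∨ ρ = rightRegular j)
    (i : K →ₜ* G) (k : K) : ∃ t : K → K, (t = (k⁻¹ * ·) ∨ t = (· * k)) ∧
      ∀ (f : algebraicFunctions j) x, (ρ (i k) f).1 (i x) = f.1 (i (t x)) := by
  rcases hρ with rfl | rfl
  · exact ⟨_, .inl rfl, fun f x => by simp [leftRegular_apply]⟩
  · exact ⟨_, .inr rfl, fun f x => by simp [rightRegular_apply]⟩

/-- The image of `K` is Zariski dense in its complexification. -/
theorem eq_zero_of_restrict_eq_zero (hi : IsComplexification EG i)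
    (hj : ∀ a b : Fin m, ContMDiff 𝓘(ℂ, EG) 𝓘(ℂ, ℂ) ω
      (fun g => (j g : Matrix (Fin m) (Fin m) ℂ) a b))
    (f : algebraicFunctions j) (hf : ∀ k, f.1 (i k) = 0) : f = 0 := by
  have hρ : rightRegular j = leftRegular j ∨ rightRegular j = rightRegular j := .inr rfl
  obtain ⟨U, hU, hfU⟩ := locallyFinite_of_regular hρ f
  -- Functions vanishing on the image of `K` are stable under right translation by `K`, hence by
  -- `G`. Evaluating the translate of `f` by `x` at `1` then gives `f x = 0`.
  let W : Submodule ℂ U.toSubmodule :=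
    { carrier := {u | ∀ k, u.1.1 (i k) = 0}
      add_mem' := fun {u v} hu hv k => by
        change u.1.1 (i k) + v.1.1 (i k) = 0
        rw [hu, hv, add_zero]
      zero_mem' := fun _ => rfl
      smul_mem' := fun c u hu k => by
        change c * u.1.1 (i k) = 0
        rw [hu, mul_zero] }
  ext x
  have h := hi.apply_mem_of_forall_apply_mem (isAnalytic_toRepresentation hj hρ U) W
    (fun k u hu x => by
      change u.1.1 (i x * i k) = 0
      rw [← map_mul]
      exact hu _) x (w := ⟨f, hfU⟩) hf 1
  change f.1 (i 1 * x) = 0 at h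
  simpa using h

end Regular

/-! ### Finite-type functions -/

section FiniteType

variable {K : Type} [Group K] [TopologicalSpace K]

/-- Since `f k` is the value at `1` of the right translate of `f` by `k`, it is a coefficient of the
translation representation on `W`. Riesz represents evaluation at `1` for an arbitrary Hilbert
structure on `W`; unitarity is not required. -/
theorem isFiniteType_of_mem_translation_invariant [ContinuousMul K] (W : Submodule ℂ (K → ℂ))
    [FiniteDimensional ℂ W] (hc : ∀ w ∈ W, Continuous w)
    (hW : ∀ k, ∀ w ∈ W, (fun x => w (x * k)) ∈ W) {f : K → ℂ} (hf : f ∈ W) : IsFiniteType K f := by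
  by_cases hn : Nontrivial W
  swap
  · rw [not_nontrivial_iff_subsingleton] at hn
    have : f = 0 := congrArg Subtype.val (Subsingleton.elim (⟨f, hf⟩ : W) 0)
    rw [this]
    exact Submodule.zero_mem _
  refine Submodule.subset_span ?_
  let R : Representation ℂ K W :=
    { toFun := fun k =>
        { toFun := fun w => ⟨_, hW k w.1 w.2⟩
          map_add' := fun _ _ => rfl
          map_smul' := fun _ _ => rfl }
      map_one' := by ext w x; simp
      map_mul' := fun k k' => by ext w x; simp [mul_assoc] }
  let E := EuclideanSpace ℂ (Fin (Module.finrank ℂ W))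
  let e : W ≃ₗ[ℂ] E := (Module.finBasis ℂ W).equivFun.trans (WithLp.linearEquiv 2 ℂ _).symm
  let π : Representation ℂ K E :=
    { toFun := fun k => e.conj (R k)
      map_one' := by rw [map_one]; exact LinearEquiv.conj_id e
      map_mul' := fun k k' => by rw [map_mul]; exact LinearEquiv.conj_comp e _ _ }
  have hRc : ∀ (w : W) (l : Module.Dual ℂ W), Continuous fun k => l (R k w) := by
    intro w l
    let ev : K → Module.Dual ℂ W := fun x => LinearMap.proj x ∘ₗ W.subtype
    have hl := mem_span_range_dual ev (fun u hu => Subtype.ext (funext hu)) l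
    induction hl using Submodule.span_induction with
    | mem l hl =>
      obtain ⟨x, rfl⟩ := hl
      exact (hc w.1 w.2).comp (continuous_const_mul x)
    | zero => exact continuous_const
    | add l l' _ _ ih ih' => exact ih.add ih'
    | smul c l _ ih => exact continuous_const.mul ih
  have hπc : ∀ v : E, Continuous fun k => π k v := by
    intro v
    refine (PiLp.continuous_toLp 2 _).comp (continuous_pi fun a => ?_)
    exact hRc (e.symm v) ((Module.finBasis ℂ W).coord a)
  refine ⟨E, inferInstance, inferInstance, inferInstance, e.symm.toEquiv.nontrivial, π, ?_,
    (InnerProductSpace.toDual ℂ E).symm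
      (LinearMap.toContinuousLinearMap (LinearMap.proj 1 ∘ₗ W.subtype ∘ₗ e.symm.toLinearMap)),
    e ⟨f, hf⟩, ?_⟩
  · let b := (EuclideanSpace.basisFun (Fin (Module.finrank ℂ W)) ℂ).toBasis
    have : ∀ p : K × E, π p.1 p.2 = ∑ c, p.2 c • π p.1 (b c) := by
      intro p
      conv_lhs => rw [← b.sum_repr p.2, map_sum]
      simp [b]
    simp only [this]
    refine continuous_finsetSum _ fun c _ => ?_
    have h1 : Continuous fun p : K × E => p.2 c :=
      (EuclideanSpace.proj c : E →L[ℂ] ℂ).continuous.comp continuous_snd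
    have h2 : Continuous fun p : K × E => π p.1 (b c) := (hπc _).comp continuous_fst
    exact h1.smul h2
  · funext k
    rw [InnerProductSpace.toDual_symm_apply]
    simp [π, LinearEquiv.conj_apply, R]

variable {G : Type} [Group G] [TopologicalSpace G] {m : ℕ} {j : G →* GL (Fin m) ℂ}

/-- Restriction of algebraic functions along `i`. -/
def restrictAlgebraic (j : G →* GL (Fin m) ℂ) (i : K →ₜ* G) :
    algebraicFunctions j →ₗ[ℂ] (K → ℂ) where
  toFun f := fun k => f.1 (i k)
  map_add' _ _ := rfl
  map_smul' _ _ := rfl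

theorem isFiniteType_restrict [ContinuousMul K] (i : K →ₜ* G)
    (hc : ∀ f ∈ algebraicFunctions j, Continuous f) (f : algebraicFunctions j) :
    IsFiniteType K fun k => f.1 (i k) := by
  obtain ⟨U, hU, hf, hUi⟩ := exists_twoSided_invariant j f
  have : FiniteDimensional ℂ (U.map (restrictAlgebraic j i)) := Module.Finite.iff_fg.2 (hU.map _)
  refine isFiniteType_of_mem_translation_invariant (U.map (restrictAlgebraic j i)) ?_ ?_
    ⟨f, hf, rfl⟩
  · rintro _ ⟨u, hu, rfl⟩
    exact (hc u.1 u.2).comp i.continuous_toFun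
  · rintro k _ ⟨u, hu, rfl⟩
    exact ⟨_, hUi 1 (i k) u hu, by ext x; simp [restrictAlgebraic]⟩

/-- The conjugates `conj(p)` serve as the test functions `h` in the Mathieu Conjecture. -/
theorem isFiniteType_star_restrict [ContinuousMul K] (i : K →ₜ* G)
    (hc : ∀ f ∈ algebraicFunctions j, Continuous f) (f : algebraicFunctions j) :
    IsFiniteType K fun k => star (f.1 (i k)) := by
  obtain ⟨U, hU, hf, hUi⟩ := exists_twoSided_invariant j f
  let r : algebraicFunctions j →ₛₗ[starRingEnd ℂ] (K → ℂ) :=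
    (starLinearEquiv ℂ : (K → ℂ) ≃ₗ⋆[ℂ] (K → ℂ)).toLinearMap.comp (restrictAlgebraic j i)
  have : FiniteDimensional ℂ (U.map r) := Module.Finite.iff_fg.2 (hU.map r)
  refine isFiniteType_of_mem_translation_invariant (U.map r) ?_ ?_ ⟨f, hf, rfl⟩
  · rintro _ ⟨u, hu, rfl⟩
    exact ((hc u.1 u.2).comp i.continuous_toFun).star
  · rintro k _ ⟨u, hu, rfl⟩
    exact ⟨_, hUi 1 (i k) u hu, by ext x; simp [r, restrictAlgebraic]⟩

end FiniteType

/-! ### The isotypical decomposition of the algebra of algebraic functions -/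

section Main

open MeasureTheory

/-- Every function in a copy of `π` is a matrix coefficient of `π`, so the component embeds in the
image of `V* ⊗ V`. -/
theorem finiteDimensional_isotypicPart {G : Type} [Group G] {m : ℕ} {j : G →* GL (Fin m) ℂ}
    {ρ : Representation ℂ G (algebraicFunctions j)}
    (hρ : ρ = leftRegular j ∨ ρ = rightRegular j) {V : Type*} [AddCommGroup V] [Module ℂ V]
    [FiniteDimensional ℂ V] (π : Representation ℂ G V) :
    FiniteDimensional ℂ (isotypicPart ρ π) := by
  obtain ⟨s, hs⟩ := exists_apply_eq_apply_one hρ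
  let B : TensorProduct ℂ (Module.Dual ℂ V) V →ₗ[ℂ] (G → ℂ) :=
    TensorProduct.lift (LinearMap.mk₂ ℂ (fun l v x => l (π (s x) v))
      (fun _ _ _ => rfl) (fun _ _ _ => rfl)
      (fun _ _ _ => by ext; simp) (fun _ _ _ => by ext; simp))
  have hle : isotypicPart ρ π ≤
      (LinearMap.range B).comap (algebraicFunctions j).val.toLinearMap := by
    refine iSup₂_le fun W hW => ?_
    obtain ⟨e⟩ : Nonempty (W.toRepresentation.Equiv π) := hW
    intro w hw
    let l : Module.Dual ℂ V := LinearMap.proj 1 ∘ₗ (algebraicFunctions j).val.toLinearMap ∘ₗ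
      W.toSubmodule.subtype ∘ₗ e.toLinearEquiv.symm.toLinearMap
    refine ⟨TensorProduct.tmul ℂ l (e ⟨w, hw⟩), ?_⟩
    ext x
    have h : e (W.toRepresentation (s x) ⟨w, hw⟩) = π (s x) (e ⟨w, hw⟩) :=
      LinearMap.congr_fun (e.toIntertwiningMap.isIntertwining' (s x)) ⟨w, hw⟩
    have h' : e.toLinearEquiv.symm (π (s x) (e ⟨w, hw⟩)) = W.toRepresentation (s x) ⟨w, hw⟩ := by
      rw [← h]
      exact e.toLinearEquiv.symm_apply_apply _
    change (e.toLinearEquiv.symm (π (s x) (e ⟨w, hw⟩))).1.1 1 = w.1 x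
    rw [h', hs w x]
    rfl
  let F : isotypicPart ρ π →ₗ[ℂ] LinearMap.range B :=
    ((algebraicFunctions j).val.toLinearMap ∘ₗ (isotypicPart ρ π).subtype).codRestrict _
      fun p => hle p.2
  exact Module.Finite.of_injective F fun p q h =>
    Subtype.ext (Subtype.ext (show F p = (F q : G → ℂ) from congrArg Subtype.val h))

theorem mem_isotypicPart_trivial {G A : Type*} [Group G] [AddCommGroup A] [Module ℂ A]
    (ρ : Representation ℂ G A) {a : A} (ha : ∀ g, ρ g a = a) :
    a ∈ isotypicPart ρ (Representation.trivial ℂ G ℂ) := by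
  by_cases h0 : a = 0
  · rw [h0]; exact Submodule.zero_mem _
  have hfix : ∀ g, ∀ v ∈ Submodule.span ℂ {a}, ρ g v = v := by
    intro g v hv
    obtain ⟨c, rfl⟩ := Submodule.mem_span_singleton.1 hv
    rw [map_smul, ha]
  let W : Subrepresentation ρ :=
    { toSubmodule := Submodule.span ℂ {a}
      apply_mem_toSubmodule := fun g v hv => by rwa [hfix g v hv] }
  have hW : Nonempty (W.toRepresentation.Equiv (Representation.trivial ℂ G ℂ)) :=
    ⟨Representation.Equiv.mk (LinearEquiv.toSpanNonzeroSingleton ℂ A a h0).symm fun g => by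
      ext v
      have : W.toRepresentation g v = v := Subtype.ext (hfix g v.1 v.2)
      change (LinearEquiv.toSpanNonzeroSingleton ℂ A a h0).symm (W.toRepresentation g v) = _
      rw [this]
      rfl⟩
  have hle : W.toSubmodule ≤ isotypicPart ρ (Representation.trivial ℂ G ℂ) :=
    le_iSup₂_of_le W hW le_rfl
  exact hle (Submodule.mem_span_singleton_self a)

theorem isIrreducible_trivial (G : Type*) [Group G] :
    (Representation.trivial ℂ G ℂ).IsIrreducible where
  exists_pair_ne := ⟨⊥, ⊤, fun h =>
    bot_ne_top (α := Submodule ℂ ℂ) (congrArg Subrepresentation.toSubmodule h)⟩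
  eq_bot_or_eq_top S := (eq_bot_or_eq_top (α := Submodule ℂ ℂ) S.toSubmodule).imp
    (fun h => Subrepresentation.toSubmodule_injective h)
    (fun h => Subrepresentation.toSubmodule_injective h)

variable {K : Type} [Group K] [TopologicalSpace K] [IsTopologicalGroup K] [CompactSpace K]
  {EG : Type} [NormedAddCommGroup EG] [NormedSpace ℂ EG]
  {G : Type} [Group G] [TopologicalSpace G] {m : ℕ} {j : G →* GL (Fin m) ℂ}

section Inner

variable [MeasurableSpace K] [BorelSpace K] (μ : Measure K) [μ.IsHaarMeasure]

/-- The inner product of `L²(K)` on algebraic functions. -/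
@[reducible]
noncomputable def l2Core (i : K →ₜ* G) (hc : ∀ f ∈ algebraicFunctions j, Continuous f)
    (hd : ∀ f : algebraicFunctions j, (∀ k, f.1 (i k) = 0) → f = 0) :
    InnerProductSpace.Core ℂ (algebraicFunctions j) where
  inner f g := ∫ k, star (f.1 (i k)) * g.1 (i k) ∂μ
  conj_inner_symm f g := by
    rw [← integral_conj]
    simp [mul_comm]
  re_inner_nonneg f := by
    have : ∀ k, star (f.1 (i k)) * f.1 (i k) = ((‖f.1 (i k)‖ ^ 2 : ℝ) : ℂ) := fun k => by
      rw [Complex.star_def, Complex.conj_mul']; norm_cast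
    simp only [this, integral_complex_ofReal, RCLike.re_to_complex, Complex.ofReal_re]
    exact integral_nonneg fun k => by positivity
  add_left f g h := by
    have hck : ∀ f ∈ algebraicFunctions j, Continuous fun k => f (i k) :=
      fun f hf => (hc f hf).comp i.continuous_toFun
    rw [← integral_add]
    · simp [add_mul]
    · exact ((hck f.1 f.2).star.mul (hck h.1 h.2)).integrable_of_compactSpace μ
    · exact ((hck g.1 g.2).star.mul (hck h.1 h.2)).integrable_of_compactSpace μ
  smul_left f g c := by
    rw [← integral_const_mul]
    simp [mul_assoc]
  definite f hf := by
    refine hd f fun k => ?_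
    have hck : Continuous fun k => ‖f.1 (i k)‖ ^ 2 :=
      (((hc f.1 f.2).comp i.continuous_toFun).norm.pow 2)
    have : ∀ k, star (f.1 (i k)) * f.1 (i k) = ((‖f.1 (i k)‖ ^ 2 : ℝ) : ℂ) := fun k => by
      rw [Complex.star_def, Complex.conj_mul']; norm_cast
    simp only [this, integral_complex_ofReal, Complex.ofReal_eq_zero] at hf
    rw [integral_eq_zero_iff_of_nonneg (fun k => by positivity)
      (hck.integrable_of_compactSpace μ)] at hf
    -- Haar measure charges every nonempty open set, so a continuous function vanishing almost
    -- everywhere is zero.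
    have h := (hck.ae_eq_iff_eq μ continuous_const).1 hf
    exact norm_eq_zero.1 (pow_eq_zero_iff two_ne_zero |>.1 (congrFun h k))

end Inner

variable [ChartedSpace EG G]

/-- Unitarity gives equivariance under `K`. To pass to `G`, the projection is restricted to a
finite-dimensional subrepresentation containing both `a` and `W`, where the representation is
analytic. -/
theorem IsComplexification.projectionsEquivariant {K : Type} [Group K] [TopologicalSpace K]
    {i : K →ₜ* G} (hi : IsComplexification EG i)
    {A : Type} [NormedAddCommGroup A] [InnerProductSpace ℂ A] {ρ : Representation ℂ G A}
    (hlf : ρ.LocallyFinite)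
    (han : ∀ (U : Subrepresentation ρ) [FiniteDimensional ℂ U.toSubmodule],
      Representation.IsAnalytic (G := G) (U := U.toSubmodule) EG U.toRepresentation)
    (hinv : ∀ k a b, inner ℂ (ρ (i k) a) (ρ (i k) b) = inner ℂ a b) :
    ρ.ProjectionsEquivariant := by
  intro W _ g a
  have hK : ∀ k a, W.toSubmodule.starProjection (ρ (i k) a) =
      ρ (i k) (W.toSubmodule.starProjection a) := by
    intro k a
    refine Submodule.eq_starProjection_of_mem_orthogonal
      (W.apply_mem_toSubmodule _ (Submodule.starProjection_apply_mem _ a)) ?_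
    rw [← map_sub]
    intro w hw
    have : w = ρ (i k) (ρ (i k⁻¹) w) := by
      rw [← Module.End.mul_apply, ← map_mul, ← map_mul, mul_inv_cancel, map_one, map_one]
      rfl
    rw [this, hinv]
    exact Submodule.sub_starProjection_mem_orthogonal a _ (W.apply_mem_toSubmodule _ hw)
  obtain ⟨U, hU, ha⟩ := hlf a
  have : FiniteDimensional ℂ (U ⊔ W).toSubmodule :=
    Submodule.finiteDimensional_sup U.toSubmodule W.toSubmodule
  have hWle : W.toSubmodule ≤ (U ⊔ W).toSubmodule := le_sup_right (a := U.toSubmodule)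
  have hUle : U.toSubmodule ≤ (U ⊔ W).toSubmodule := le_sup_left (b := W.toSubmodule)
  let T : Module.End ℂ (U ⊔ W).toSubmodule :=
    W.toSubmodule.starProjection.toLinearMap.restrict
      fun v _ => hWle (Submodule.starProjection_apply_mem _ v)
  have h := hi.commute_linear (U := (U ⊔ W).toSubmodule) (han (U ⊔ W)) T
    (fun k u => Subtype.ext (hK k u.1).symm) g ⟨a, hUle ha⟩
  exact (congrArg Subtype.val h).symm

variable [LieGroup 𝓘(ℂ, EG) ω G] {ρ : Representation ℂ G (algebraicFunctions j)}

theorem integral_star_mul_regular [MeasurableSpace K] [BorelSpace K] (μ : Measure K)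
    [μ.IsHaarMeasure] [IsProbabilityMeasure μ] (i : K →ₜ* G)
    (hρ : ρ = leftRegular j ∨ ρ = rightRegular j) (k : K) (f g : algebraicFunctions j) :
    ∫ x, star ((ρ (i k) f).1 (i x)) * (ρ (i k) g).1 (i x) ∂μ =
      ∫ x, star (f.1 (i x)) * g.1 (i x) ∂μ := by
  have := isMulRightInvariant_of_compactSpace μ
  obtain ⟨t, ht, h⟩ := regular_apply_restrict hρ i k
  simp only [h]
  rcases ht with rfl | rfl
  · exact integral_mul_left_eq_self (fun x => star (f.1 (i x)) * g.1 (i x)) k⁻¹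
  · exact integral_mul_right_eq_self (fun x => star (f.1 (i x)) * g.1 (i x)) k

/-- The Mathieu property for all isotypical components. -/
theorem isotypic_of_mathieu [MeasurableSpace K] [BorelSpace K] (μ : Measure K)
    [μ.IsHaarMeasure] [IsProbabilityMeasure μ] {i : K →ₜ* G} (hi : IsComplexification EG i)
    (hj : ∀ a b : Fin m, ContMDiff 𝓘(ℂ, EG) 𝓘(ℂ, ℂ) ω
      (fun g => (j g : Matrix (Fin m) (Fin m) ℂ) a b))
    (hρ : ρ = leftRegular j ∨ ρ = rightRegular j)
    (hM : ∀ f h : K → ℂ, IsFiniteType K f → IsFiniteType K h →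
      (∀ n : ℕ, 1 ≤ n → ∫ k, f k ^ n ∂μ = 0) →
      ∃ N : ℕ, ∀ n : ℕ, N ≤ n → ∫ k, f k ^ n * h k ∂μ = 0)
    (f : algebraicFunctions j)
    (hf : ∀ n : ℕ, 1 ≤ n → isotypicProj ρ (Representation.trivial ℂ G ℂ) (f ^ n) = 0)
    {V : Type*} [AddCommGroup V] [Module ℂ V] [FiniteDimensional ℂ V]
    (π : Representation ℂ G V) (hπ : π.IsIrreducible) :
    IsCompl (isotypicPart ρ π) (isotypicRest ρ π) ∧
      ∃ N : ℕ, ∀ n : ℕ, N ≤ n → isotypicProj ρ π (f ^ n) = 0 := by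
  have hc : ∀ f ∈ algebraicFunctions j, Continuous f := fun f hf =>
    (contMDiff_of_mem_algebraicFunctions hj hf).continuous
  have hd : ∀ f : algebraicFunctions j, (∀ k, f.1 (i k) = 0) → f = 0 :=
    eq_zero_of_restrict_eq_zero hi hj
  let _ : NormedAddCommGroup (algebraicFunctions j) := (l2Core μ i hc hd).toNormedAddCommGroup
  let _ : InnerProductSpace ℂ (algebraicFunctions j) := .ofCore (l2Core μ i hc hd).toCore
  have hinner : ∀ f g : algebraicFunctions j,
      inner ℂ f g = ∫ k, star (f.1 (i k)) * g.1 (i k) ∂μ := fun _ _ => rfl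
  have hlf : ρ.LocallyFinite := locallyFinite_of_regular hρ
  have hq : Representation.ProjectionsEquivariant ρ :=
    hi.projectionsEquivariant (ρ := ρ) hlf (fun U _ => isAnalytic_toRepresentation hj hρ U)
      (integral_star_mul_regular μ i hρ)
  refine ⟨isCompl_isotypicPart_isotypicRest hq hlf hπ, ?_⟩
  -- The constant `1` lies in the trivial component, and pairing it with `f ^ n` is integration over
  -- `K`.
  have hint : ∀ n : ℕ, 1 ≤ n → ∫ k, f.1 (i k) ^ n ∂μ = 0 := by
    intro n hn
    have h := inner_isotypicProj hq hlf (isIrreducible_trivial G)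
      (mem_isotypicPart_trivial ρ (regular_one hρ)) (f ^ n)
    rw [hf n hn, inner_zero_right, hinner] at h
    simpa using h.symm
  have hp : ∀ p : algebraicFunctions j, ∃ N : ℕ, ∀ n : ℕ, N ≤ n → inner ℂ p (f ^ n) = 0 := by
    intro p
    obtain ⟨N, hN⟩ := hM _ _ (isFiniteType_restrict i hc f) (isFiniteType_star_restrict i hc p) hint
    refine ⟨N, fun n hn => ?_⟩
    rw [hinner, ← hN n hn]
    simp [mul_comm]
  choose N hN using hp
  have := finiteDimensional_isotypicPart hρ π
  let b := Module.finBasis ℂ (isotypicPart ρ π)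
  -- The bound depends on the test vector, so the maximum over a finite basis is taken.
  refine ⟨Finset.univ.sup fun c => N (b c), fun n hn => ?_⟩
  have hb : ∀ c, inner ℂ (b c : algebraicFunctions j) (f ^ n) = 0 := fun c =>
    hN _ n ((Finset.le_sup (f := fun c => N (b c)) (Finset.mem_univ c)).trans hn)
  have hall : ∀ p ∈ isotypicPart ρ π, inner ℂ p (f ^ n) = 0 := by
    intro p hp
    have : p = ∑ c, b.repr ⟨p, hp⟩ c • (b c : algebraicFunctions j) := by
      have := congrArg (isotypicPart ρ π).subtype (b.sum_repr ⟨p, hp⟩)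
      rw [map_sum] at this
      exact this.symm
    rw [this, sum_inner]
    exact Finset.sum_eq_zero fun c _ => by rw [inner_smul_left, hb, mul_zero]
  -- With `p = (f^n)_π`, the norm squared `⟨p, p⟩` equals `⟨p, f^n⟩`, which is zero.
  rw [← inner_self_eq_zero (𝕜 := ℂ),
    inner_isotypicProj hq hlf hπ (isotypicProj_mem ρ π (f ^ n))]
  exact hall _ (isotypicProj_mem ρ π (f ^ n))

end Main

theorem mainTheorem7
    -- a compact connected matrix Lie group `K`
    (m : ℕ) (K : Subgroup (GL (Fin m) ℂ)) [CompactSpace K] [ConnectedSpace K]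
    -- its complexification `i : K → G`, a complex Lie group
    (EG : Type) [NormedAddCommGroup EG] [NormedSpace ℂ EG] [FiniteDimensional ℂ EG]
    (G : Type) [Group G] [TopologicalSpace G] [ChartedSpace EG G] [LieGroup 𝓘(ℂ, EG) ω G]
    (i : K →ₜ* G) (hi : IsComplexification EG i)
    -- the (unique) analytic extension to `G` of the inclusion of `K` into the matrices
    (j : G →* GL (Fin m) ℂ)
    (hj : ∀ a b : Fin m, ContMDiff 𝓘(ℂ, EG) 𝓘(ℂ, ℂ) ω
      (fun g => (j g : Matrix (Fin m) (Fin m) ℂ) a b))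
    (hji : ∀ k : K, j (i k) = (k : GL (Fin m) ℂ))
    -- the action of `G` on `ℂ[G]`, by left or by right translations
    (ρ : Representation ℂ G (algebraicFunctions j))
    (hρ : ρ = leftRegular j ∨ ρ = rightRegular j)
    (hM : MathieuConjecture K)
    (f : algebraicFunctions j)
    (hf : ∀ n : ℕ, 1 ≤ n → isotypicProj ρ (Representation.trivial ℂ G ℂ) (f ^ n) = 0)
    -- a finite-dimensional irreducible representation `π` of `G`
    (V : Type*) [NormedAddCommGroup V] [InnerProductSpace ℂ V] [FiniteDimensional ℂ V]
    (π : Representation ℂ G V) (hπc : Continuous fun p : G × V => π p.1 p.2)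
    (hπ : π.IsIrreducible) :
    -- `(·)_π` is well defined, and `(f ^ n)_π = 0` for all large `n`
    IsCompl (isotypicPart ρ π) (isotypicRest ρ π) ∧
      ∃ N : ℕ, ∀ n : ℕ, N ≤ n → isotypicProj ρ π (f ^ n) = 0 := by
  let _ : MeasurableSpace K := borel K
  have : BorelSpace K := ⟨rfl⟩
  have : (normalizedHaar K).IsHaarMeasure :=
    inferInstanceAs (MeasureTheory.Measure.haarMeasure
      (⊤ : TopologicalSpace.PositiveCompacts K)).IsHaarMeasure
  have : MeasureTheory.IsProbabilityMeasure (normalizedHaar K) :=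
    ⟨MeasureTheory.Measure.haarMeasure_self⟩
  exact isotypic_of_mathieu (normalizedHaar K) hi hj hρ hM f hf π hπ
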